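/- Let $P\subset\mathbb{R}^d$ be a full-dimensional polytope (the convex hull of finitely many points, with nonempty interior). A face of a set $K\subseteq\mathbb{R}^d$ is either $\emptyset$ or a nonempty set of the form $S(K;c)=\{x\in K : \langle y,c\rangle\le\langle x,c\rangle \text{ for all } y\in K\}$ with $c\in\mathbb{R}^d$; the faces $\emptyset$ and $K$ are called trivial, and the face lattice of $K$ is the set of all its faces ordered by inclusion. The outer normal cone of $P$ at a nonempty face $F$ is $\mathcal N(F;P)=\{c\in\mathbb{R}^d : F=S(P;c)\}$. Assume that $P$ is perfectly centered, that is, $\operatorname{relint}(F)\cap\mathcal N(F;P)\neq\emptyset$ for every nonempty face $F$ of $P$ (including $F=P$). Let $P^*=\{x\in\mathbb{R}^d : \langle x,y\rangle\le 1 \text{ for all } y\in P\}$ be the dual of $P$, let $F^D=\{x\in P^* : \langle x,f\rangle=1 \text{ for all } f\in F\}$ for every face $F$ of $P$, and let $P+P^*$ be the Minkowski sum (the Nesterov rounding of $P$). 1. A set $H\subseteq\mathbb{R}^d$ is a nontrivial face of $P+P^*$ if and only if $H=G+F^D$ for some nontrivial faces $G\subseteq F$ of $P$. 2. The face lattice of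 $P+P^*$ is determined by that of $P$: if $Q\subset\mathbb{R}^e$ is another full-dimensional perfectly centered polytope ($e$ need not equal $d$) and the face lattices of $P$ and $Q$ are isomorphic, then the face lattices of $P+P^*$ and $Q+Q^*$ are isomorphic. -/

import Mathlib

open scoped Pointwise

namespace Polytope

variable {E : Type*} [NormedAddCommGroup E] [InnerProductSpace ℝ E]

/-- A (convex) polytope: the convex hull of finitely many points. -/
def IsPolytope (P : Set E) : Prop :=
  ∃ V : Set E, V.Finite ∧ P = convexHull ℝ V

/-- A face of `P`: the empty set, or the set of maximizers over `P` of a linear functional.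
This includes `P` itself (zero functional) and `∅`. -/
def IsFace (P F : Set E) : Prop :=
  IsExposed ℝ P F

/-- A nontrivial face: a face other than `∅` and `P`. -/
def IsNontrivialFace (P F : Set E) : Prop :=
  IsFace P F ∧ F ≠ ∅ ∧ F ≠ P

/-- The face lattice of `P`: all faces (`∅` and `P` included), ordered by inclusion. -/
abbrev FaceLattice (P : Set E) : Type _ :=
  {F : Set E // IsFace P F}

/-- `S(P; c)`, the set of maximizers of `⟨·, c⟩` over `P`. -/
def maximizers (P : Set E) (c : E) : Set E :=
  {x ∈ P | ∀ y ∈ P, inner ℝ y c ≤ inner ℝ x c}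

/-- The (relatively open) outer normal cone `N(F; P)` of `P` at `F`: all `c` with
`F = S(P; c)`. -/
def normalCone (F P : Set E) : Set E :=
  {c | F = maximizers P c}

/-- `P` is perfectly centered: the relative interior of every nonempty face meets the outer
normal cone at that face. -/
def PerfectlyCentered (P : Set E) : Prop :=
  ∀ F : Set E, IsFace P F → F.Nonempty → (intrinsicInterior ℝ F ∩ normalCone F P).Nonempty

/-- The dual `P* = {x : ⟨x, y⟩ ≤ 1 for all y ∈ P}`. -/
def dual (P : Set E) : Set E :=
  {x | ∀ y ∈ P, inner ℝ x y ≤ 1}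

/-- The dual face `F^D = {x ∈ P* : ⟨x, f⟩ = 1 for all f ∈ F}` of a face `F` of `P`. -/
def dualFace (P F : Set E) : Set E :=
  {x ∈ dual P | ∀ f ∈ F, inner ℝ x f = 1}

/-- The Nesterov rounding `P + P*` (Minkowski sum). -/
def nesterovRounding (P : Set E) : Set E :=
  P + dual P

end Polytope

namespace Polytope

/-! ### Maximizers of linear functionals. -/

variable {E : Type*} [NormedAddCommGroup E] [InnerProductSpace ℝ E]

/-! Maximizers split over a Minkowski sum: `S(P + P*; c) = S(P; c) + S(P*; c)`. So the nonempty
faces of `P + P*` are governed by which pairs `(S(P; c), S(P*; c))` occur.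

Since `P` is full-dimensional, its center is `0`, so every `c ≠ 0` scales to a point `p` of a proper
face of `P` without changing the maximizers. Then `S(P*; p)` is the dual face of the smallest face
`F` containing `p`. The crux is that `G = S(P; p)` lies in `F`
(`PerfectlyCentered.maximizers_subset`): the maximizers of `⟨·, p⟩` lie in every face through `p`.
Conversely, if `G ⊆ F` have centers `g` and `f`, the functional `f + t • g` with small `t > 0`
selects `G` in `P`, and a multiple of it is a point of `F` that selects the dual face of `F` in `P*`
(`PerfectlyCentered.exists_maximizers_eq`).

For the second claim, `G + F^D ⊆ G' + F'^D` holds exactly when `G ⊆ G'` and `F' ⊆ F`. Hence the face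
lattice of `P + P*` is the order of pairs `G ⊆ F` of nontrivial faces, reversed in `F`, with two
bounds adjoined. This is built from the face lattice of `P` alone. -/

theorem isFace_maximizers (P : Set E) (c : E) : IsFace P (maximizers P c) := fun _ =>
  ⟨innerSL ℝ c, by ext x; simp [maximizers, real_inner_comm c]⟩

theorem maximizers_subset (P : Set E) (c : E) : maximizers P c ⊆ P := fun _ hx => hx.1

theorem maximizers_zero (P : Set E) : maximizers P 0 = P := by
  ext x; simp [maximizers]

theorem maximizers_smul (P : Set E) (c : E) {r : ℝ} (hr : 0 < r) :
    maximizers P (r • c) = maximizers P c := by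
  ext x; simp [maximizers, inner_smul_right, mul_le_mul_iff_right₀ hr]

theorem maximizers_nonempty {P : Set E} (hP : IsCompact P) (hne : P.Nonempty) (c : E) :
    (maximizers P c).Nonempty := by
  obtain ⟨x, hx, h⟩ := hP.exists_isMaxOn hne
    (f := fun x => inner ℝ x c) (by fun_prop)
  exact ⟨x, hx, fun y hy => h hy⟩

theorem mem_maximizers_iff {P : Set E} {c w x : E} (hw : w ∈ maximizers P c) :
    x ∈ maximizers P c ↔ x ∈ P ∧ inner ℝ x c = inner ℝ w c :=
  ⟨fun hx => ⟨hx.1, le_antisymm (hw.2 x hx.1) (hx.2 w hw.1)⟩,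
    fun hx => ⟨hx.1, fun y hy => hx.2 ▸ hw.2 y hy⟩⟩

/-- A maximizer over `P` lying in `B` stays one over `B`. -/
theorem maximizers_of_subset {P B : Set E} {c : E} (hB : B ⊆ P) (h : maximizers P c ⊆ B)
    (hne : (maximizers P c).Nonempty) : maximizers B c = maximizers P c := by
  obtain ⟨w, hw⟩ := hne
  have hwB : w ∈ maximizers B c := ⟨h hw, fun y hy => hw.2 y (hB hy)⟩
  ext x
  rw [mem_maximizers_iff hw, mem_maximizers_iff hwB]
  exact ⟨fun hx => ⟨hB hx.1, hx.2⟩, fun hx => ⟨h ((mem_maximizers_iff hw).2 hx), hx.2⟩⟩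

/-- The maximizers of a positive combination of two functionals with common maximizers. -/
theorem maximizers_add {P : Set E} {a b : E}
    (hne : (maximizers P a ∩ maximizers P b).Nonempty) :
    maximizers P (a + b) = maximizers P a ∩ maximizers P b := by
  obtain ⟨w, hwa, hwb⟩ := hne
  ext x
  simp only [maximizers, Set.mem_inter_iff, Set.mem_ofPred_eq, inner_add_right]
  constructor
  · rintro ⟨hx, h⟩
    have h1 := h w hwa.1
    have h2 := hwa.2 x hx
    have h3 := hwb.2 x hx
    exact ⟨⟨hx, fun y hy => by linarith [hwa.2 y hy]⟩, ⟨hx, fun y hy => by linarith [hwb.2 y hy]⟩⟩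
  · rintro ⟨⟨hx, h1⟩, ⟨_, h2⟩⟩
    exact ⟨hx, fun y hy => by linarith [h1 y hy, h2 y hy]⟩

/-- Maximizers over a Minkowski sum. -/
theorem maximizers_sum {P Q : Set E} {c : E} (hP : (maximizers P c).Nonempty)
    (hQ : (maximizers Q c).Nonempty) :
    maximizers (P + Q) c = maximizers P c + maximizers Q c := by
  obtain ⟨p, hp⟩ := hP
  obtain ⟨q, hq⟩ := hQ
  ext x
  constructor
  · rintro ⟨⟨a, ha, b, hb, rfl⟩, h⟩
    have h1 := h (p + q) (Set.add_mem_add hp.1 hq.1)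
    simp only [inner_add_left] at h1
    have h2 := hp.2 a ha
    have h3 := hq.2 b hb
    exact Set.add_mem_add ((mem_maximizers_iff hp).2 ⟨ha, by linarith⟩)
      ((mem_maximizers_iff hq).2 ⟨hb, by linarith⟩)
  · rintro ⟨a, ha, b, hb, rfl⟩
    refine ⟨Set.add_mem_add ha.1 hb.1, ?_⟩
    rintro _ ⟨a', ha', b', hb', rfl⟩
    simp only [inner_add_left]
    exact add_le_add (ha.2 a' ha') (hb.2 b' hb')

/-- If `x + y` maximizes over `P + Q` then `x` and `y` both maximize. -/
theorem mem_maximizers_of_add_mem {P Q : Set E} {c x y : E} (hx : x ∈ P) (hy : y ∈ Q)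
    (h : x + y ∈ maximizers (P + Q) c) : x ∈ maximizers P c ∧ y ∈ maximizers Q c := by
  refine ⟨⟨hx, fun p hp => ?_⟩, ⟨hy, fun q hq => ?_⟩⟩
  · simpa [inner_add_left] using h.2 _ (Set.add_mem_add hp hy)
  · simpa [inner_add_left] using h.2 _ (Set.add_mem_add hx hq)

/-- A functional that is constant on a set with nonempty interior vanishes. -/
theorem eq_zero_of_maximizers_eq {K : Set E} (hK : (interior K).Nonempty) {c : E}
    (h : maximizers K c = K) : c = 0 := by
  obtain ⟨x, hx⟩ := hK
  -- Moving from an interior point `x` in direction `c` raises the functional by `t * ⟨c, c⟩`, yet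
  -- `x` is already a maximizer.
  have hcont : Filter.Tendsto (fun t : ℝ => x + t • c) (nhdsWithin 0 (Set.Ioi 0)) (nhds x) := by
    have : Continuous fun t : ℝ => x + t • c := by fun_prop
    simpa using (this.tendsto 0).mono_left nhdsWithin_le_nhds
  obtain ⟨t, ht, ht0⟩ := ((hcont.eventually (mem_interior_iff_mem_nhds.1 hx)).and
    self_mem_nhdsWithin).exists
  have hxm : x ∈ maximizers K c := h.symm ▸ interior_subset hx
  have h1 := hxm.2 _ ht
  rw [inner_add_left, inner_smul_left] at h1
  have h2 : inner ℝ c c ≤ 0 := by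
    simp only [conj_trivial] at h1
    exact nonpos_of_mul_nonpos_right (by linarith) ht0
  exact inner_self_eq_zero.1 (le_antisymm h2 real_inner_self_nonneg)

theorem IsFace.exists_eq_maximizers [FiniteDimensional ℝ E] {P F : Set E} (h : IsFace P F) (hne : F.Nonempty) :
    ∃ c, F = maximizers P c := by
  obtain ⟨l, hl⟩ := h hne
  refine ⟨(InnerProductSpace.toDual ℝ E).symm l, ?_⟩
  have hin : ∀ x, (inner ℝ x ((InnerProductSpace.toDual ℝ E).symm l) : ℝ) = l x := fun x => by
    rw [real_inner_comm, InnerProductSpace.toDual_symm_apply]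
  rw [hl]
  simp only [maximizers, hin]

/-! ### Faces of polytopes. -/

theorem IsPolytope.isCompact {P : Set E} (hP : IsPolytope P) : IsCompact P := by
  obtain ⟨V, hV, rfl⟩ := hP
  exact hV.isCompact_convexHull ℝ

theorem IsPolytope.convex {P : Set E} (hP : IsPolytope P) : Convex ℝ P := by
  obtain ⟨V, hV, rfl⟩ := hP
  exact convex_convexHull ℝ V

/-- Krein–Milman: extreme points of a face are extreme in the whole hull, hence belong to `V`. -/
theorem IsFace.eq_convexHull {V B : Set E} (hV : V.Finite) (hB : IsFace (convexHull ℝ V) B) :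
    B = convexHull ℝ (V ∩ B) := by
  have hc : IsCompact (convexHull ℝ V) := hV.isCompact_convexHull ℝ
  have hBc : IsCompact B := IsExposed.isCompact hB hc
  have hBconv : Convex ℝ B := IsExposed.convex hB (convex_convexHull ℝ V)
  apply subset_antisymm
  · have hsub : B.extremePoints ℝ ⊆ V ∩ B := fun x hx =>
      ⟨extremePoints_convexHull_subset ((IsExposed.isExtreme hB).extremePoints_subset_extremePoints hx),
        hx.1⟩
    have hcl : IsClosed (convexHull ℝ (V ∩ B)) :=
      ((hV.subset Set.inter_subset_left).isCompact_convexHull ℝ).isClosed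
    calc B = closure (convexHull ℝ (B.extremePoints ℝ)) :=
          (closure_convexHull_extremePoints hBc hBconv).symm
      _ ⊆ closure (convexHull ℝ (V ∩ B)) := closure_mono (convexHull_mono hsub)
      _ = _ := hcl.closure_eq
  · exact convexHull_min Set.inter_subset_right hBconv

theorem finite_faces {P : Set E} (hP : IsPolytope P) : {F : Set E | IsFace P F}.Finite := by
  obtain ⟨V, hV, rfl⟩ := hP
  refine Set.Finite.of_finite_image (f := fun B => V ∩ B)
    (hV.finite_subsets.subset ?_) ?_
  · rintro _ ⟨B, _, rfl⟩
    exact Set.inter_subset_left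
  · intro A hA B hB h
    rw [IsFace.eq_convexHull hV hA, IsFace.eq_convexHull hV hB]
    exact congrArg _ h

/-- Maximizing a small perturbation of a functional amounts to maximizing lexicographically. -/
theorem eventually_maximizers_add_smul {P : Set E} (hP : IsPolytope P) (b u : E) :
    ∀ᶠ t : ℝ in nhdsWithin 0 (Set.Ioi 0),
      maximizers P (b + t • u) = maximizers (maximizers P b) u := by
  rcases P.eq_empty_or_nonempty with rfl | hne
  · simp [maximizers]
  have hPc := hP.isCompact
  have hB := maximizers_nonempty hPc hne b
  have hBc : IsCompact (maximizers P b) := IsExposed.isCompact (isFace_maximizers P b) hPc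
  obtain ⟨w, hw⟩ := maximizers_nonempty hBc hB u
  obtain ⟨V, hV, rfl⟩ := hP
  -- Generators outside `S(P; b)` lose to `w` by a positive margin at `t = 0`. There are finitely
  -- many, so one small `t` works for all.
  have key : ∀ v ∈ V \ maximizers (convexHull ℝ V) b, ∀ᶠ t : ℝ in nhdsWithin 0 (Set.Ioi 0),
      inner ℝ v (b + t • u) < inner ℝ w (b + t • u) := by
    rintro v ⟨hv, hvB⟩
    have hvP := subset_convexHull ℝ V hv
    have hlt : inner ℝ v b < inner ℝ w b := by
      refine lt_of_le_of_ne (hw.1.2 v hvP) fun h => hvB ?_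
      exact (mem_maximizers_iff hw.1).2 ⟨hvP, h⟩
    have h1 : Continuous fun t : ℝ => (inner ℝ v (b + t • u) : ℝ) := by fun_prop
    have h2 : Continuous fun t : ℝ => (inner ℝ w (b + t • u) : ℝ) := by fun_prop
    refine nhdsWithin_le_nhds ((h1.tendsto 0).eventually_lt (h2.tendsto 0) ?_)
    simpa using hlt
  filter_upwards [(Filter.eventually_all_finite hV.sdiff).2 key, self_mem_nhdsWithin] with t ht ht0
  have ht0 : 0 < t := ht0
  set c := b + t • u with hc
  have hcin : ∀ x, (inner ℝ x c : ℝ) = inner ℝ x b + t * inner ℝ x u := fun x => by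
    rw [hc, inner_add_right, inner_smul_right]
  have hwc : w ∈ maximizers (convexHull ℝ V) c := by
    refine ⟨hw.1.1, ?_⟩
    have hhalf : Convex ℝ {y : E | inner ℝ y c ≤ inner ℝ w c} := by
      have := convex_halfSpace_le (𝕜 := ℝ) (f := fun y : E => (inner ℝ y c : ℝ))
        ⟨fun x y => inner_add_left _ _ _, fun a x => by simp [inner_smul_left]⟩ (inner ℝ w c)
      exact this
    refine convexHull_min (fun v hv => ?_) hhalf
    by_cases hvB : v ∈ maximizers (convexHull ℝ V) b
    · have h1 := ((mem_maximizers_iff hw.1).1 hvB).2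
      have h2 := hw.2 v hvB
      change (inner ℝ v c : ℝ) ≤ inner ℝ w c
      rw [hcin, hcin, h1]
      gcongr
    · exact (ht v ⟨hv, hvB⟩).le
  have hsub : maximizers (convexHull ℝ V) c ⊆ maximizers (convexHull ℝ V) b := by
    rw [IsFace.eq_convexHull hV (isFace_maximizers _ c)]
    refine convexHull_min ?_ (IsExposed.convex (isFace_maximizers _ b) (convex_convexHull ℝ V))
    rintro v ⟨hv, hvc⟩
    by_contra hvB
    exact absurd (hvc.2 w hwc.1) (not_le.2 (ht v ⟨hv, hvB⟩))
  ext x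
  rw [mem_maximizers_iff hw]
  constructor
  · intro hx
    refine ⟨hsub hx, ?_⟩
    have h1 := ((mem_maximizers_iff hwc).1 hx).2
    have h2 := ((mem_maximizers_iff hw.1).1 (hsub hx)).2
    rw [hcin, hcin, h2] at h1
    exact mul_left_cancel₀ ht0.ne' (by linarith)
  · rintro ⟨hx, h⟩
    refine (mem_maximizers_iff hwc).2 ⟨hx.1, ?_⟩
    rw [hcin, hcin, ((mem_maximizers_iff hw.1).1 hx).2, h]

/-- A face of a face of a polytope is a face. -/
theorem IsFace.trans [FiniteDimensional ℝ E] {P B F : Set E} (hP : IsPolytope P) (hB : IsFace P B) (hF : IsFace B F) :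
    IsFace P F := by
  rcases F.eq_empty_or_nonempty with rfl | hne
  · exact fun h => absurd h Set.not_nonempty_empty
  obtain ⟨u, rfl⟩ := hF.exists_eq_maximizers hne
  obtain ⟨b, rfl⟩ := hB.exists_eq_maximizers (hne.mono (maximizers_subset _ _))
  obtain ⟨t, ht⟩ := (eventually_maximizers_add_smul hP b u).exists
  rw [← ht]
  exact isFace_maximizers _ _

/-- As `F` meets `B`, the functional exposing `F` attains on `B` its maximum over `P`. -/
theorem IsFace.restrict {P B F : Set E} (hF : IsFace P F) (hB : B ⊆ P) : IsFace B (F ∩ B) := by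
  intro hne
  obtain ⟨l, hl⟩ := hF (hne.mono Set.inter_subset_left)
  obtain ⟨w, hwF, hwB⟩ := hne
  refine ⟨l, ?_⟩
  rw [hl] at hwF ⊢
  ext x
  exact ⟨fun hx => ⟨hx.2, fun y hy => hx.1.2 y (hB hy)⟩,
    fun hx => ⟨⟨hB hx.1, fun y hy => (hwF.2 y hy).trans (hx.2 w hwB)⟩, hx.1⟩⟩

/-! ### Relative interiors and boundary points. -/

/-- Around a point of the relative interior, `P` contains a ball of its affine span. -/
theorem exists_ball_of_mem_intrinsicInterior {P : Set E} {z : E}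
    (hz : z ∈ intrinsicInterior ℝ P) :
    ∃ ε > 0, ∀ w ∈ (affineSpan ℝ P).direction, ‖w‖ < ε → z + w ∈ P := by
  obtain ⟨y, hy, rfl⟩ := mem_intrinsicInterior.1 hz
  obtain ⟨ε, hε, h⟩ := Metric.mem_nhds_iff.1 (mem_interior_iff_mem_nhds.1 hy)
  refine ⟨ε, hε, fun w hw hwε => ?_⟩
  have hmem : w +ᵥ (y : E) ∈ affineSpan ℝ P := AffineSubspace.vadd_mem_of_mem_direction hw y.2
  have := @h ⟨w +ᵥ (y : E), hmem⟩ (by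
    rw [Metric.mem_ball, Subtype.dist_eq, dist_eq_norm]; simpa using hwε)
  simpa [add_comm] using this

/-- A face meeting the relative interior of `F` contains `F`. -/
theorem IsFace.subset_of_mem_intrinsicInterior {P F A : Set E} {f : E} (hA : IsFace P A)
    (hF : F ⊆ P) (hf : f ∈ intrinsicInterior ℝ F) (hfA : f ∈ A) : F ⊆ A := by
  obtain ⟨l, rfl⟩ := hA ⟨f, hfA⟩
  intro y hy
  obtain ⟨ε, hε, h⟩ := exists_ball_of_mem_intrinsicInterior hf
  have hfF := intrinsicInterior_subset hf
  have hdir : f - y ∈ (affineSpan ℝ F).direction :=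
    AffineSubspace.vsub_mem_direction (subset_affineSpan ℝ F hfF) (subset_affineSpan ℝ F hy)
  -- Going slightly past `f`, away from `y`, stays in `F`; maximality of `f` there forces `l f ≤ l
  -- y`.
  obtain ⟨δ, hδ, hδε⟩ : ∃ δ : ℝ, 0 < δ ∧ ‖δ • (f - y)‖ < ε := by
    refine ⟨ε / (‖f - y‖ + 1), by positivity, ?_⟩
    rw [norm_smul, Real.norm_of_nonneg (by positivity), div_mul_eq_mul_div,
      div_lt_iff₀ (by positivity)]
    nlinarith [norm_nonneg (f - y)]
  have hmem := h _ (Submodule.smul_mem _ δ hdir) hδε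
  have h1 := hfA.2 _ (hF hmem)
  simp only [map_add, map_smul, map_sub, smul_eq_mul] at h1
  have h2 : l f ≤ l y := by nlinarith
  exact ⟨hF hy, fun x hx => (hfA.2 x hx).trans h2⟩

/-- A ray from a point of the relative interior leaves `P` through a proper face. -/
theorem exists_mem_proper_face [FiniteDimensional ℝ E] {P : Set E} (hPc : IsCompact P) (hPconv : Convex ℝ P) {z x : E}
    (hz : z ∈ intrinsicInterior ℝ P) (hx : x ∈ P) (hxz : x ≠ z) :
    ∃ s : ℝ, 1 ≤ s ∧ ∃ B, IsFace P B ∧ B ≠ P ∧ z + s • (x - z) ∈ B := by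
  have hzP := intrinsicInterior_subset hz
  obtain ⟨ε, hε, hball⟩ := exists_ball_of_mem_intrinsicInterior hz
  set W := (affineSpan ℝ P).direction with hW
  have hPW : ∀ y ∈ P, y - z ∈ W := fun y hy =>
    AffineSubspace.vsub_mem_direction (subset_affineSpan ℝ P hy) (subset_affineSpan ℝ P hzP)
  -- the last parameter at which the ray is in `P`
  obtain ⟨s, hs1, hsP, hsmax⟩ : ∃ s : ℝ, 1 ≤ s ∧ z + s • (x - z) ∈ P ∧
      ∀ t, s < t → z + t • (x - z) ∉ P := by
    have hcl : IsClosed {t : ℝ | z + t • (x - z) ∈ P} :=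
      hPc.isClosed.preimage (by fun_prop : Continuous fun t : ℝ => z + t • (x - z))
    obtain ⟨R, hR⟩ := hPc.isBounded.subset_closedBall z
    have hbdd : BddAbove {t : ℝ | z + t • (x - z) ∈ P} := by
      refine ⟨R / ‖x - z‖, fun t ht => ?_⟩
      have := hR ht
      rw [Metric.mem_closedBall, dist_eq_norm, add_sub_cancel_left, norm_smul] at this
      rw [le_div_iff₀ (norm_pos_iff.2 (sub_ne_zero.2 hxz))]
      exact (mul_le_mul_of_nonneg_right (le_abs_self t) (norm_nonneg _)).trans this
    have h1 : (1 : ℝ) ∈ {t : ℝ | z + t • (x - z) ∈ P} := by simpa using hx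
    refine ⟨sSup {t : ℝ | z + t • (x - z) ∈ P}, le_csSup hbdd h1, hcl.csSup_mem ⟨1, h1⟩ hbdd, ?_⟩
    exact fun t ht hmem => absurd (le_csSup hbdd hmem) (not_le.2 ht)
  refine ⟨s, hs1, ?_⟩
  -- Translated into the direction space, `P` has `0` in its interior, so Hahn–Banach separates
  -- strictly from `0` and the resulting face is proper.
  set K : Set W := {w | z + (w : E) ∈ P} with hK
  have hKconv : Convex ℝ K := by
    intro a ha b hb r t hr ht hrt
    have := hPconv ha hb hr ht hrt
    rw [hK, Set.mem_ofPred_eq]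
    convert this using 1
    simp only [Submodule.coe_add, Submodule.coe_smul, smul_add]
    rw [add_add_add_comm, ← add_smul, hrt, one_smul]
  have h0 : (0 : W) ∈ interior K := by
    refine mem_interior_iff_mem_nhds.2 (Metric.mem_nhds_iff.2 ⟨ε, hε, fun w hw => ?_⟩)
    exact hball w w.2 (by simpa using hw)
  set q : W := ⟨s • (x - z), W.smul_mem s (hPW x hx)⟩ with hq
  have hqi : q ∉ interior K := by
    intro hqi
    have hcont : Filter.Tendsto (fun t : ℝ => t • q) (nhdsWithin 1 (Set.Ioi 1)) (nhds q) := by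
      have : Continuous fun t : ℝ => t • q := by fun_prop
      simpa using (this.tendsto 1).mono_left nhdsWithin_le_nhds
    obtain ⟨t, ht, ht1⟩ := ((hcont.eventually (mem_interior_iff_mem_nhds.1 hqi)).and
      self_mem_nhdsWithin).exists
    have ht1 : 1 < t := ht1
    -- The ray would continue beyond its last parameter: `t > 1` and `s ≥ 1` give `t * s > s`.
    refine hsmax (t * s) (by nlinarith) ?_
    have : z + ((t • q : W) : E) ∈ P := ht
    simpa [hq, mul_smul] using this
  obtain ⟨f, hf⟩ := geometric_hahn_banach_open_point hKconv.interior isOpen_interior hqi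
  have hfle : ∀ w ∈ K, f w ≤ f q := by
    have hcl : IsClosed {w : W | f w ≤ f q} := isClosed_le f.continuous continuous_const
    have hsub : closure (interior K) ⊆ {w : W | f w ≤ f q} :=
      closure_minimal (fun w hw => (hf w hw).le) hcl
    intro w hw
    refine hsub ?_
    rw [hKconv.closure_interior_eq_closure_of_nonempty_interior ⟨0, h0⟩]
    exact subset_closure hw
  set l : E →L[ℝ] ℝ := f.comp W.orthogonalProjectionOnto with hl
  have hlW : ∀ w : W, l w = f w := fun w => by simp [hl]
  have hlP : ∀ y (hy : y ∈ P), l y = l z + f ⟨y - z, hPW y hy⟩ := fun y hy => by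
    rw [← hlW]; simp
  refine ⟨{y ∈ P | ∀ y' ∈ P, l y' ≤ l y}, fun _ => ⟨l, rfl⟩, ?_, hsP, ?_⟩
  · intro h
    have hz' : z ∈ {y ∈ P | ∀ y' ∈ P, l y' ≤ l y} := h.symm ▸ hzP
    have h1 := hz'.2 _ hsP
    have h2 := hf 0 h0
    have h3 : l (z + s • (x - z)) = l z + f q := by
      rw [map_add, ← hlW q]
    rw [map_zero] at h2
    linarith
  · intro y' hy'
    have h3 : l (z + s • (x - z)) = l z + f q := by
      rw [map_add, ← hlW q]
    rw [h3, hlP y' hy']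
    have : f ⟨y' - z, hPW y' hy'⟩ ≤ f q := hfle _ (by simpa [hK] using hy')
    linarith

/-! ### Perfectly centered polytopes: maximizers lie in every face through the point. -/

/-- Faces of `B` are faces of `P`, and the center of such a face in `P` exposes it within `B` as
well. This permits induction on faces. -/
theorem PerfectlyCentered.of_isFace [FiniteDimensional ℝ E] {P B : Set E} (hP : IsPolytope P)
    (hpc : PerfectlyCentered P) (hB : IsFace P B) : PerfectlyCentered B := by
  intro F hF hne
  obtain ⟨f, hfF, hf⟩ := hpc F (hB.trans hP hF) hne
  have hf : F = maximizers P f := hf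
  have hBP : B ⊆ P := IsExposed.subset hB
  have hFB : F ⊆ B := IsExposed.subset hF
  refine ⟨f, hfF, ?_⟩
  rw [hf] at hFB hne
  change F = maximizers B f
  rw [maximizers_of_subset hBP hFB hne, hf]

/-- In a perfectly centered polytope, every face containing a point `c` also contains the points
maximizing `⟨·, c⟩`. -/
theorem PerfectlyCentered.maximizers_subset [FiniteDimensional ℝ E] {P : Set E}
    (hP : IsPolytope P) (hpc : PerfectlyCentered P) {F : Set E} (hF : IsFace P F) {c : E}
    (hc : c ∈ F) : maximizers P c ⊆ F := by
  -- Induction on the number of generators: a proper face is the hull of strictly fewer of them.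
  obtain ⟨V, hV, hPV⟩ := id hP
  induction hn : V.ncard using Nat.strong_induction_on generalizing V P F c with
  | _ n ih =>
  have hFP : F ⊆ P := IsExposed.subset hF
  have hPne : P.Nonempty := ⟨c, hFP hc⟩
  rcases eq_or_ne F P with rfl | hFne
  · exact Polytope.maximizers_subset _ _
  have hrec : ∀ B, IsFace P B → B ≠ P → ∀ F', IsFace B F' → ∀ c ∈ F', maximizers B c ⊆ F' := by
    intro B hB hBne F' hF' c hc
    have hBV : B = convexHull ℝ (V ∩ B) := (hPV ▸ hB).eq_convexHull hV
    refine ih _ ?_ ⟨_, hV.subset Set.inter_subset_left, hBV⟩ (hpc.of_isFace hP hB) hF' hc (V ∩ B)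
      (hV.subset Set.inter_subset_left) hBV rfl
    rw [← hn]
    refine Set.ncard_lt_ncard (Set.inter_subset_left.ssubset_of_ne fun h => hBne ?_) hV
    rw [hBV, h, hPV]
  have hPface : IsFace P P := by
    have := isFace_maximizers P 0
    rwa [maximizers_zero] at this
  obtain ⟨z, hzi, hz⟩ := hpc P hPface hPne
  have hz : P = maximizers P z := hz
  have hzP := intrinsicInterior_subset hzi
  -- `⟨·, z⟩` is constant on `P`, so adding multiples of `z` to a functional does not change its
  -- maximizers over `P`.
  have hzc : ∀ x ∈ P, (inner ℝ x z : ℝ) = inner ℝ z z := fun x hx =>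
    ((mem_maximizers_iff (hz ▸ hzP)).1 (hz ▸ hx)).2
  set G := maximizers P c with hG
  have hGface : IsFace P G := isFace_maximizers P c
  have hGne : G.Nonempty := maximizers_nonempty hP.isCompact hPne c
  have hGP : G ⊆ P := Polytope.maximizers_subset _ _
  have hcen : ∀ B, ∃ b, IsFace P B → B.Nonempty → b ∈ B ∧ B = maximizers P b := by
    intro B
    by_cases h : IsFace P B ∧ B.Nonempty
    · obtain ⟨b, hb, hb'⟩ := hpc B h.1 h.2
      exact ⟨b, fun _ _ => ⟨intrinsicInterior_subset hb, hb'⟩⟩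
    · exact ⟨0, fun h1 h2 => absurd ⟨h1, h2⟩ h⟩
  choose b hb using hcen
  -- Normalized so that on `P` one has `φ B ≤ 1`, with equality exactly on `B`, while `φ B` is
  -- homogeneous along rays from `z`. The maximum over proper faces acts as a gauge of `P` about
  -- `z`.
  set φ : Set E → E → ℝ := fun B x => inner ℝ (x - z) (b B - z) / ‖b B - z‖ ^ 2 with hφ
  have hpos : ∀ B, IsFace P B → B.Nonempty → B ≠ P → 0 < ‖b B - z‖ ^ 2 := by
    intro B hB hne hBP
    have : b B ≠ z := fun h => hBP (by rw [(hb B hB hne).2, h, ← hz])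
    have := norm_pos_iff.2 (sub_ne_zero.2 this)
    positivity
  have hnum : ∀ B, IsFace P B → B.Nonempty → ∀ x ∈ P,
      (inner ℝ (x - z) (b B - z) : ℝ) = ‖b B - z‖ ^ 2 + (inner ℝ x (b B) - inner ℝ (b B) (b B)) := by
    intro B hB hne x hx
    have h1 := hzc x hx
    have h2 := hzc (b B) (IsExposed.subset hB (hb B hB hne).1)
    rw [← real_inner_self_eq_norm_sq]
    simp only [inner_sub_left, inner_sub_right]
    linarith
  have hφle : ∀ B, IsFace P B → B.Nonempty → B ≠ P → ∀ x ∈ P, φ B x ≤ 1 := by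
    intro B hB hne hBP x hx
    have hm := (hb B hB hne)
    rw [hφ, div_le_one (hpos B hB hne hBP), hnum B hB hne x hx]
    have := (hm.2 ▸ hm.1 : b B ∈ maximizers P (b B)).2 x hx
    linarith
  have hφeq : ∀ B, IsFace P B → B.Nonempty → B ≠ P → ∀ x ∈ P, φ B x = 1 ↔ x ∈ B := by
    intro B hB hne hBP x hx
    have hm := (hb B hB hne)
    have hm' : b B ∈ maximizers P (b B) := hm.2 ▸ hm.1
    have hiff := mem_maximizers_iff (x := x) hm'
    rw [← hm.2] at hiff
    rw [hφ, div_eq_one_iff_eq (hpos B hB hne hBP).ne', hnum B hB hne x hx, hiff]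
    constructor
    · exact fun h => ⟨hx, by linarith⟩
    · rintro ⟨_, h⟩
      linarith
  have hφray : ∀ B s x, φ B (z + s • (x - z)) = s * φ B x := by
    intro B s x
    simp only [hφ, add_sub_cancel_left, inner_smul_left, conj_trivial, mul_div_assoc]
  have hφcont : ∀ B, Continuous (φ B) := fun B => by
    simp only [hφ]
    fun_prop
  by_contra hGF
  -- if `G = P` then `c` is the center of `F`
  rcases eq_or_ne G P with hGeq | hGPne
  · obtain ⟨hfF, hf⟩ := hb F hF ⟨c, hc⟩
    have hm : b F ∈ maximizers P (b F) := by rw [← hf]; exact hfF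
    have hcG : c ∈ maximizers P c := by rw [← hG, hGeq]; exact hFP hc
    have hfG : b F ∈ maximizers P c := by rw [← hG, hGeq]; exact hFP hfF
    have h1 := ((mem_maximizers_iff hcG).1 hfG).2
    have h2 := ((mem_maximizers_iff hm).1 (hf ▸ hc : c ∈ maximizers P (b F))).2
    have h3 : (inner ℝ (c - b F) (c - b F) : ℝ) = 0 := by
      simp only [inner_sub_left, inner_sub_right]
      linarith
    have h4 : c = b F := sub_eq_zero.1 (inner_self_eq_zero.1 h3)
    exact hGF (by rw [hG, h4, ← hf])
  set 𝓑 : Set (Set E) := {B | IsFace P B ∧ B.Nonempty ∧ B ≠ P} with h𝓑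
  have h𝓑fin : 𝓑.Finite := (finite_faces hP).subset fun B hB => hB.1
  obtain ⟨hkG, hk⟩ := hb G hGface hGne
  set k := b G with hkdef
  -- The segment from `c` to the center `k` of `G`: both endpoints have `G` as maximizers, hence so
  -- does every point between.
  set γ : ℝ → E := fun t => c + t • (k - c) with hγ
  have hγcont : Continuous γ := by fun_prop
  have hγP : ∀ t ∈ Set.Icc (0 : ℝ) 1, γ t ∈ P := fun t ht =>
    hP.convex.add_smul_sub_mem (hFP hc) (hGP hkG) ht
  have hγmax : ∀ t ∈ Set.Icc (0 : ℝ) 1, maximizers P (γ t) = G := by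
    intro t ht
    rcases ht.1.eq_or_lt with rfl | h0
    · simp [hγ, hG]
    rcases ht.2.eq_or_lt with rfl | h1
    · simp [hγ, ← hk]
    have e1 : maximizers P ((1 - t) • c) = G := by rw [maximizers_smul _ _ (by linarith)]
    have e2 : maximizers P (t • k) = G := by rw [maximizers_smul _ _ h0, ← hk]
    have : γ t = (1 - t) • c + t • k := by simp only [hγ]; module
    rw [this, maximizers_add (by rw [e1, e2, Set.inter_self]; exact hGne), e1, e2, Set.inter_self]
  have hclosed : ∀ p : Set E → Prop,
      IsClosed {t | ∃ B ∈ 𝓑, p B ∧ ∀ B' ∈ 𝓑, φ B' (γ t) ≤ φ B (γ t)} := by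
    intro p
    have : {t | ∃ B ∈ 𝓑, p B ∧ ∀ B' ∈ 𝓑, φ B' (γ t) ≤ φ B (γ t)} =
        ⋃ B ∈ {B ∈ 𝓑 | p B}, ⋂ B' ∈ 𝓑, {t | φ B' (γ t) ≤ φ B (γ t)} := by
      ext t
      simp [and_assoc]
    rw [this]
    refine (h𝓑fin.subset fun B hB => hB.1).isClosed_biUnion fun B _ => ?_
    exact isClosed_biInter fun B' _ =>
      isClosed_le ((hφcont B').comp hγcont) ((hφcont B).comp hγcont)
  have hG𝓑 : G ∈ 𝓑 := ⟨hGface, hGne, hGPne⟩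
  -- At `t = 1` the face `G` attains the largest `φ`, at `t = 0` the face `F` does, and `G ⊄ F`. The
  -- two closed conditions cover the connected interval, so at some `t` a face containing `G` and
  -- one not containing `G` both attain it.
  obtain ⟨t, ht, ⟨B, hB, hGB, hBmax⟩, ⟨B', hB', hGB', hBmax'⟩⟩ :=
    isPreconnected_closed_iff.1 (isPreconnected_Icc (a := (0 : ℝ)) (b := 1)) _ _
      (hclosed fun B => G ⊆ B) (hclosed fun B => ¬ G ⊆ B)
      (by
        intro t _
        obtain ⟨B, hB, hmax⟩ := h𝓑fin.exists_maximalFor (fun B => φ B (γ t)) _ ⟨G, hG𝓑⟩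
        have hmax' : ∀ B' ∈ 𝓑, φ B' (γ t) ≤ φ B (γ t) := fun B' hB' =>
          (le_total (φ B' (γ t)) (φ B (γ t))).elim id (hmax hB')
        by_cases h : G ⊆ B
        · exact Or.inl ⟨B, hB, h, hmax'⟩
        · exact Or.inr ⟨B, hB, h, hmax'⟩)
      ⟨1, by simp, G, hG𝓑, subset_rfl, fun B' hB' => by
        have h1 : γ 1 = k := by simp [hγ]
        rw [h1, (hφeq G hGface hGne hGPne k (hGP hkG)).2 hkG]
        exact hφle B' hB'.1 hB'.2.1 hB'.2.2 k (hGP hkG)⟩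
      ⟨0, by simp, F, ⟨hF, ⟨c, hc⟩, hFne⟩, hGF, fun B' hB' => by
        have h1 : γ 0 = c := by simp [hγ]
        rw [h1, (hφeq F hF ⟨c, hc⟩ hFne c (hFP hc)).2 hc]
        exact hφle B' hB'.1 hB'.2.1 hB'.2.2 c (hFP hc)⟩
  have hxz : γ t ≠ z := fun h => hGPne (by rw [← hγmax t ht, h, ← hz])
  obtain ⟨s, hs, B₀, hB₀, hB₀P, hp⟩ :=
    exists_mem_proper_face hP.isCompact hP.convex hzi (hγP t ht) hxz
  set p := z + s • (γ t - z) with hpdef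
  have hpP : p ∈ P := IsExposed.subset hB₀ hp
  have hB₀𝓑 : B₀ ∈ 𝓑 := ⟨hB₀, ⟨p, hp⟩, hB₀P⟩
  -- The ray scales every `φ` by the same `s`, and `φ B₀ p = 1`, so each face maximal at `γ t`
  -- reaches the value `1` at `p`.
  have hmem : ∀ A ∈ 𝓑, (∀ B' ∈ 𝓑, φ B' (γ t) ≤ φ A (γ t)) → p ∈ A := by
    intro A hA hAmax
    rw [← hφeq A hA.1 hA.2.1 hA.2.2 p hpP]
    refine le_antisymm (hφle A hA.1 hA.2.1 hA.2.2 p hpP) ?_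
    rw [← (hφeq B₀ hB₀ ⟨p, hp⟩ hB₀P p hpP).2 hp, hφray, hφray]
    exact mul_le_mul_of_nonneg_left (hAmax B₀ hB₀𝓑) (by linarith)
  have hpB := hmem B hB hBmax
  have hpB' := hmem B' hB' hBmax'
  have hpG : maximizers P p = G := by
    have hs0 : 0 < s := by linarith
    have e1 : maximizers P (s • γ t) = G := by rw [maximizers_smul _ _ hs0, hγmax t ht]
    have e2 : maximizers P ((1 - s) • z) = P := by
      ext x
      refine ⟨fun hx => hx.1, fun hx => ⟨hx, fun y hy => ?_⟩⟩
      rw [inner_smul_right, inner_smul_right, hzc x hx, hzc y hy]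
    have : p = s • γ t + (1 - s) • z := by rw [hpdef]; module
    rw [this, maximizers_add, e1, e2, Set.inter_eq_left.2 hGP]
    rw [e1, e2, Set.inter_eq_left.2 hGP]
    exact hGne
  have hBP : B ⊆ P := IsExposed.subset hB.1
  have hBG : maximizers B p = G := by
    rw [maximizers_of_subset hBP (hpG ▸ hGB) (hpG ▸ hGne), hpG]
  -- Within the smaller polytope `B`, the face `B' ∩ B` contains `p`, so it contains `S(B; p) = G`,
  -- contradicting the choice of `B'`.
  have := hrec B hB.1 hB.2.2 (B' ∩ B) (hB'.1.restrict hBP) p ⟨hpB', hpB⟩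
  rw [hBG] at this
  exact hGB' (this.trans Set.inter_subset_left)

/-! ### Dual faces and the nontrivial faces of the Nesterov rounding. -/

section NesterovRounding

variable {P : Set E}

theorem isFace_empty (P : Set E) : IsFace P ∅ := fun h => absurd h Set.not_nonempty_empty

theorem isFace_self (P : Set E) : IsFace P P := by
  have := isFace_maximizers P 0
  rwa [maximizers_zero] at this

/-- The center of a full-dimensional perfectly centered polytope is the origin. -/
theorem PerfectlyCentered.zero_mem (hfull : (interior P).Nonempty) (hpc : PerfectlyCentered P) :
    (0 : E) ∈ intrinsicInterior ℝ P := by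
  obtain ⟨z, hz, hzP⟩ := hpc P (isFace_self P) (hfull.mono interior_subset)
  have : z = 0 := eq_zero_of_maximizers_eq hfull (Eq.symm hzP)
  rwa [this] at hz

theorem PerfectlyCentered.exists_center (hpc : PerfectlyCentered P) {F : Set E}
    (hF : IsNontrivialFace P F) :
    ∃ f ∈ intrinsicInterior ℝ F, maximizers P f = F ∧ 0 < (inner ℝ f f : ℝ) := by
  obtain ⟨f, hf, hfF⟩ := hpc F hF.1 (Set.nonempty_iff_ne_empty.2 hF.2.1)
  have hfF : F = maximizers P f := hfF
  refine ⟨f, hf, hfF.symm, real_inner_self_pos.2 ?_⟩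
  rintro rfl
  exact hF.2.2 (hfF.trans (maximizers_zero P))

/-- Every nontrivial face of `P` is cut out by a point of its dual face. -/
theorem PerfectlyCentered.exists_mem_dualFace (hpc : PerfectlyCentered P) {F : Set E}
    (hF : IsNontrivialFace P F) :
    ∃ a ∈ dualFace P F, ∀ y ∈ P, inner ℝ a y = (1 : ℝ) → y ∈ F := by
  obtain ⟨f, hf, hfF, hpos⟩ := hpc.exists_center hF
  have hfm : f ∈ maximizers P f := hfF ▸ intrinsicInterior_subset hf
  have hval : ∀ y, (inner ℝ ((inner ℝ f f : ℝ)⁻¹ • f) y : ℝ) = inner ℝ y f / inner ℝ f f := by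
    intro y
    rw [real_inner_smul_left, real_inner_comm y f, div_eq_inv_mul]
  refine ⟨(inner ℝ f f : ℝ)⁻¹ • f, ⟨fun y hy => ?_, fun y hy => ?_⟩, fun y hy h => ?_⟩
  · rw [hval, div_le_one hpos]
    exact hfm.2 y hy
  · rw [hval, div_eq_one_iff_eq hpos.ne']
    exact ((mem_maximizers_iff hfm).1 (hfF ▸ hy)).2
  · rw [hval, div_eq_one_iff_eq hpos.ne'] at h
    rw [← hfF]
    exact (mem_maximizers_iff hfm).2 ⟨hy, h⟩

/-- The functional `⟨x, ·⟩` is at most `1` on `P`, so `1` is its maximum as soon as it is attained.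
-/
theorem isFace_of_mem_dual {x : E} (hx : x ∈ dual P) : IsFace P {y ∈ P | inner ℝ x y = (1 : ℝ)} := by
  rintro ⟨w, hw, hwx⟩
  refine ⟨innerSL ℝ x, ?_⟩
  ext y
  simp only [Set.mem_ofPred_eq, innerSL_apply_apply]
  constructor
  · rintro ⟨hy, h⟩
    exact ⟨hy, fun y' hy' => h ▸ hx y' hy'⟩
  · rintro ⟨hy, h⟩
    exact ⟨hy, le_antisymm (hx y hy) (hwx ▸ h w hw)⟩

theorem maximizers_dual {p a : E} (hp : p ∈ P) (ha : a ∈ dual P) (hap : inner ℝ a p = (1 : ℝ)) :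
    maximizers (dual P) p = {x ∈ dual P | inner ℝ x p = (1 : ℝ)} := by
  ext x
  constructor
  · rintro ⟨hx, h⟩
    exact ⟨hx, le_antisymm (hx p hp) (hap ▸ h a ha)⟩
  · rintro ⟨hx, h⟩
    exact ⟨hx, fun y hy => h ▸ hy p hp⟩

theorem dualFace_empty (P : Set E) : dualFace P ∅ = dual P := by
  simp [dualFace]

theorem dualFace_anti (P : Set E) {F F' : Set E} (h : F ⊆ F') : dualFace P F' ⊆ dualFace P F :=
  fun _ hx => ⟨hx.1, fun f hf => hx.2 f (h hf)⟩

theorem zero_mem_dual (P : Set E) : (0 : E) ∈ dual P := fun y _ => by simp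

theorem interior_nesterovRounding_nonempty (hfull : (interior P).Nonempty) :
    (interior (nesterovRounding P)).Nonempty := by
  refine hfull.mono (interior_mono fun x hx => ?_)
  have : x + 0 ∈ P + dual P := Set.add_mem_add hx (zero_mem_dual P)
  rwa [add_zero] at this

theorem nesterovRounding_nonempty (hfull : (interior P).Nonempty) :
    (nesterovRounding P).Nonempty :=
  (interior_nesterovRounding_nonempty hfull).mono interior_subset

/-- Nontrivial faces `G ⊆ F` of `P` are realized by a common functional: it is maximized over `P`
at `G` and over the dual of `P` at the dual face of `F`. -/
theorem PerfectlyCentered.exists_maximizers_eq (hP : IsPolytope P) (hpc : PerfectlyCentered P)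
    {G F : Set E} (hG : IsNontrivialFace P G) (hF : IsNontrivialFace P F) (hGF : G ⊆ F) :
    ∃ c, maximizers P c = G ∧ maximizers (dual P) c = dualFace P F := by
  obtain ⟨f, hf, hfF, -⟩ := hpc.exists_center hF
  obtain ⟨g, hg, hgG, -⟩ := hpc.exists_center hG
  obtain ⟨a, ha, -⟩ := hpc.exists_mem_dualFace hF
  have hfF' := intrinsicInterior_subset hf
  have hgG' := intrinsicInterior_subset hg
  have hFP : F ⊆ P := IsExposed.subset hF.1
  obtain ⟨t, hmax, ht⟩ := ((eventually_maximizers_add_smul hP f g).and self_mem_nhdsWithin).exists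
  have ht : 0 < t := ht
  have ht1 : 0 < 1 + t := by linarith
  -- The factor makes `c` a convex combination of `f` and `g`, hence a point of `F`; it does not
  -- affect maximizers.
  set c := (1 + t)⁻¹ • (f + t • g) with hc
  have hcin : ∀ x, (inner ℝ x c : ℝ) = (1 + t)⁻¹ * (inner ℝ x f + t * inner ℝ x g) := fun x => by
    rw [hc, inner_smul_right, inner_add_right, inner_smul_right]
  have hcF : c ∈ F := by
    have := (IsExposed.convex hF.1 hP.convex) hfF' (hGF hgG') (a := (1 + t)⁻¹)
      (b := (1 + t)⁻¹ * t) (by positivity) (by positivity) (by field_simp)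
    rwa [← smul_smul, ← smul_add] at this
  refine ⟨c, ?_, ?_⟩
  · rw [hc, maximizers_smul _ _ (by positivity), hmax, hfF,
      maximizers_of_subset hFP (hgG ▸ hGF) ⟨g, hgG ▸ hgG'⟩, hgG]
  · rw [maximizers_dual (hFP hcF) ha.1 (ha.2 c hcF)]
    ext x
    refine ⟨fun ⟨hx, h⟩ => ⟨hx, ?_⟩, fun hx => ⟨hx.1, hx.2 c hcF⟩⟩
    have h1 := hx f (hFP hfF')
    have h2 := hx g (hFP (hGF hgG'))
    rw [hcin, inv_mul_eq_one₀ ht1.ne'] at h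
    -- An average of two numbers at most `1` equals `1` only if both do. As `f` is relatively
    -- interior to `F`, the value `1` then spreads to all of `F`.
    have h3 : inner ℝ x f = (1 : ℝ) := by nlinarith
    have := (isFace_of_mem_dual hx).subset_of_mem_intrinsicInterior hFP hf ⟨hFP hfF', h3⟩
    exact fun y hy => (this hy).2

/-- Every nonzero functional is maximized over `P` at a nontrivial face `G` and over the dual of
`P` at the dual face of a nontrivial face containing `G`. -/
theorem PerfectlyCentered.exists_faces_of_ne_zero [FiniteDimensional ℝ E]
    (hP : IsPolytope P)
    (hfull : (interior P).Nonempty) (hpc : PerfectlyCentered P) {c : E} (hc : c ≠ 0) :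
    ∃ G F, IsNontrivialFace P G ∧ IsNontrivialFace P F ∧ G ⊆ F ∧ maximizers P c = G ∧
      maximizers (dual P) c = dualFace P F := by
  have h0 := hpc.zero_mem hfull
  obtain ⟨r, hr, hrP⟩ : ∃ r : ℝ, 0 < r ∧ r • c ∈ P := by
    obtain ⟨ε, hε, hball⟩ := exists_ball_of_mem_intrinsicInterior h0
    have htop : affineSpan ℝ P = ⊤ :=
      affineSpan_eq_top_of_nonempty_interior (by rwa [hP.convex.convexHull_eq])
    refine ⟨ε / (‖c‖ + 1), by positivity, ?_⟩
    have := hball ((ε / (‖c‖ + 1)) • c) (by simp [htop]) ?_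
    · rwa [zero_add] at this
    rw [norm_smul, Real.norm_of_nonneg (by positivity), div_mul_eq_mul_div,
      div_lt_iff₀ (by positivity)]
    linarith
  obtain ⟨s, hs, B, hB, hBP, hsB⟩ := exists_mem_proper_face hP.isCompact hP.convex h0 hrP
    (smul_ne_zero hr.ne' hc)
  rw [zero_add, sub_zero, smul_smul] at hsB
  have hsr : 0 < s * r := by nlinarith
  set p := (s * r) • c with hp
  have hpP : p ∈ P := IsExposed.subset hB hsB
  have hp0 : p ≠ 0 := smul_ne_zero hsr.ne' hc
  have hBn : IsNontrivialFace P B := ⟨hB, Set.Nonempty.ne_empty ⟨p, hsB⟩, hBP⟩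
  have hfin : {F : Set E | IsFace P F ∧ p ∈ F}.Finite :=
    (finite_faces hP).subset fun F hF => hF.1
  -- The smallest face through `p`. A point `x` of `P*` with `⟨x, p⟩ = 1` cuts out a face containing
  -- `p`, hence containing `F`, so `x` lies in the dual face of `F`.
  set F := ⋂₀ {F : Set E | IsFace P F ∧ p ∈ F} with hFdef
  have hFB : F ⊆ B := Set.sInter_subset_of_mem ⟨hB, hsB⟩
  have hpF : p ∈ F := Set.mem_sInter.2 fun F hF => hF.2
  have hF : IsFace P F := by
    have := IsExposed.sInter (𝕜 := ℝ) (A := P) (F := hfin.toFinset)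
      ⟨B, by simpa using ⟨hB, hsB⟩⟩ (fun A hA => ((hfin.mem_toFinset).1 hA).1)
    rwa [hfin.coe_toFinset] at this
  have hFn : IsNontrivialFace P F := ⟨hF, Set.Nonempty.ne_empty ⟨p, hpF⟩, fun h =>
    hBP ((IsExposed.subset hB).antisymm (h ▸ hFB))⟩
  refine ⟨maximizers P p, F, ⟨isFace_maximizers P p, ?_, ?_⟩, hFn,
    hpc.maximizers_subset hP hF hpF, ?_, ?_⟩
  · exact (maximizers_nonempty hP.isCompact ⟨p, hpP⟩ p).ne_empty
  · exact fun h => hp0 (eq_zero_of_maximizers_eq hfull h)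
  · rw [hp, maximizers_smul _ _ hsr]
  · obtain ⟨a, ha, -⟩ := hpc.exists_mem_dualFace hBn
    rw [← maximizers_smul _ _ hsr, ← hp, maximizers_dual hpP ha.1 (ha.2 p hsB)]
    ext x
    refine ⟨fun ⟨hx, h⟩ => ⟨hx, fun y hy => ?_⟩, fun hx => ⟨hx.1, hx.2 p hpF⟩⟩
    exact (Set.mem_sInter.1 hy _ ⟨isFace_of_mem_dual hx, hpP, h⟩).2

theorem PerfectlyCentered.nonempty_dualFace (hpc : PerfectlyCentered P) {F : Set E}
    (hF : IsNontrivialFace P F) : (dualFace P F).Nonempty :=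
  let ⟨a, ha, _⟩ := hpc.exists_mem_dualFace hF
  ⟨a, ha⟩

theorem PerfectlyCentered.exists_maximizers_nesterovRounding (hP : IsPolytope P)
    (hpc : PerfectlyCentered P) {G F : Set E} (hG : IsNontrivialFace P G)
    (hF : IsNontrivialFace P F) (hGF : G ⊆ F) :
    ∃ c, maximizers P c = G ∧ maximizers (dual P) c = dualFace P F ∧
      maximizers (nesterovRounding P) c = G + dualFace P F := by
  obtain ⟨c, hcG, hcF⟩ := hpc.exists_maximizers_eq hP hG hF hGF
  refine ⟨c, hcG, hcF, ?_⟩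
  rw [nesterovRounding, maximizers_sum, hcG, hcF]
  · rw [hcG]
    exact Set.nonempty_iff_ne_empty.2 hG.2.1
  · rw [hcF]
    exact hpc.nonempty_dualFace hF

/-- The nontrivial faces of the Nesterov rounding. -/
theorem PerfectlyCentered.isNontrivialFace_nesterovRounding_iff [FiniteDimensional ℝ E]
    (hP : IsPolytope P)
    (hfull : (interior P).Nonempty) (hpc : PerfectlyCentered P) (H : Set E) :
    IsNontrivialFace (nesterovRounding P) H ↔
      ∃ G F : Set E, IsNontrivialFace P G ∧ IsNontrivialFace P F ∧ G ⊆ F ∧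
        H = G + dualFace P F := by
  constructor
  · rintro ⟨hH, hne, hnt⟩
    obtain ⟨c, rfl⟩ := hH.exists_eq_maximizers (Set.nonempty_iff_ne_empty.2 hne)
    have hc : c ≠ 0 := by
      rintro rfl
      exact hnt (maximizers_zero _)
    obtain ⟨G, F, hG, hF, hGF, hcG, hcF⟩ := hpc.exists_faces_of_ne_zero hP hfull hc
    refine ⟨G, F, hG, hF, hGF, ?_⟩
    rw [nesterovRounding, maximizers_sum, hcG, hcF]
    · rw [hcG]
      exact Set.nonempty_iff_ne_empty.2 hG.2.1
    · rw [hcF]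
      exact hpc.nonempty_dualFace hF
  · rintro ⟨G, F, hG, hF, hGF, rfl⟩
    obtain ⟨c, hcG, hcF, hc⟩ := hpc.exists_maximizers_nesterovRounding hP hG hF hGF
    refine ⟨hc ▸ isFace_maximizers _ c, ?_, fun h => ?_⟩
    · exact ((Set.nonempty_iff_ne_empty.2 hG.2.1).add (hpc.nonempty_dualFace hF)).ne_empty
    · have hc0 := eq_zero_of_maximizers_eq (interior_nesterovRounding_nonempty hfull) (hc.trans h)
      rw [hc0, maximizers_zero] at hcG
      exact hG.2.2 hcG.symm

/-- Inclusion of nontrivial faces of the Nesterov rounding. -/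
theorem PerfectlyCentered.add_dualFace_subset_iff (hP : IsPolytope P) (hpc : PerfectlyCentered P)
    {G F G' F' : Set E} (hG : IsNontrivialFace P G) (hF : IsNontrivialFace P F)
    (hG' : IsNontrivialFace P G') (hF' : IsNontrivialFace P F') (hGF' : G' ⊆ F') :
    G + dualFace P F ⊆ G' + dualFace P F' ↔ G ⊆ G' ∧ F' ⊆ F := by
  refine ⟨fun h => ?_, fun h => Set.add_subset_add h.1 (dualFace_anti P h.2)⟩
  obtain ⟨c, hcG, hcF, hc⟩ := hpc.exists_maximizers_nesterovRounding hP hG' hF' hGF'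
  have hmem : ∀ x ∈ G, ∀ y ∈ dualFace P F, x ∈ G' ∧ y ∈ dualFace P F' := by
    intro x hx y hy
    rw [← hcG, ← hcF]
    exact mem_maximizers_of_add_mem (IsExposed.subset hG.1 hx) hy.1
      (hc.symm ▸ h (Set.add_mem_add hx hy))
  -- `a` recovers `F` from its dual face: on `P`, `⟨a, ·⟩` takes the value `1` only on `F`.
  obtain ⟨a, ha, haF⟩ := hpc.exists_mem_dualFace hF
  obtain ⟨g, hg⟩ := Set.nonempty_iff_ne_empty.2 hG.2.1
  exact ⟨fun x hx => (hmem x hx a ha).1,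
    fun y hy => haF y (IsExposed.subset hF'.1 hy) ((hmem g hg a ha).2.2 y hy)⟩

/-- Triviality of a face is thus visible in the order alone, and so preserved by lattice
isomorphisms. -/
theorem isBot_faceLattice_iff {G : FaceLattice P} : IsBot G ↔ G.1 = ∅ :=
  ⟨fun h => Set.subset_empty_iff.1 (h ⟨∅, isFace_empty P⟩),
    fun h F => by
      change G.1 ⊆ F.1
      rw [h]
      exact Set.empty_subset _⟩

theorem isTop_faceLattice_iff {G : FaceLattice P} : IsTop G ↔ G.1 = P :=
  ⟨fun h => (IsExposed.subset G.2).antisymm (h ⟨P, isFace_self P⟩),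
    fun h F => by
      change F.1 ⊆ G.1
      rw [h]
      exact IsExposed.subset F.2⟩

end NesterovRounding

/-! ### The order of flag pairs and its functoriality. -/

section FlagPairs

/-- The pairs of nontrivial elements `G ≤ F` of a bounded order, with a least and a greatest
element added in the form `(⊥, ⊤)` and `(⊤, ⊥)`. Ordered as a subset of `L × Lᵒᵈ`. -/
def IsFlagPair {L : Type*} [LE L] (p : L × Lᵒᵈ) : Prop :=
  (IsBot p.1 ∧ IsTop (OrderDual.ofDual p.2)) ∨ (IsTop p.1 ∧ IsBot (OrderDual.ofDual p.2)) ∨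
    ((¬ IsBot p.1 ∧ ¬ IsTop p.1) ∧
      (¬ IsBot (OrderDual.ofDual p.2) ∧ ¬ IsTop (OrderDual.ofDual p.2)) ∧
      p.1 ≤ OrderDual.ofDual p.2)

abbrev FlagPair (L : Type*) [LE L] : Type _ :=
  {p : L × Lᵒᵈ // IsFlagPair p}

variable {L M : Type*} [PartialOrder L] [PartialOrder M]

theorem isBot_orderIso_iff (e : L ≃o M) {x : L} : IsBot (e x) ↔ IsBot x :=
  ⟨fun h y => e.le_iff_le.1 (h (e y)), fun h y => by
    simpa using e.monotone (h (e.symm y))⟩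

theorem isTop_orderIso_iff (e : L ≃o M) {x : L} : IsTop (e x) ↔ IsTop x :=
  ⟨fun h y => e.le_iff_le.1 (h (e y)), fun h y => by
    simpa using e.monotone (h (e.symm y))⟩

theorem isFlagPair_orderIso_iff (e : L ≃o M) (p : L × Lᵒᵈ) :
    IsFlagPair (e.toEquiv.prodCongr e.dual.toEquiv p) ↔ IsFlagPair p := by
  have h2 : OrderDual.ofDual (e.toEquiv.prodCongr e.dual.toEquiv p).2 = e (OrderDual.ofDual p.2) := rfl
  have h1 : (e.toEquiv.prodCongr e.dual.toEquiv p).1 = e p.1 := rfl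
  rw [IsFlagPair, IsFlagPair, h1, h2]
  simp only [isBot_orderIso_iff, isTop_orderIso_iff, e.le_iff_le]

/-- Isomorphic orders have isomorphic orders of flag pairs. -/
def flagPairCongr (e : L ≃o M) : FlagPair L ≃o FlagPair M where
  toEquiv := (e.toEquiv.prodCongr e.dual.toEquiv).subtypeEquiv fun p => (isFlagPair_orderIso_iff e p).symm
  map_rel_iff' := and_congr e.le_iff_le e.le_iff_le

end FlagPairs

/-! ### The face lattice of the Nesterov rounding as flag pairs. -/

section FaceLattice

variable {P : Set E}

theorem not_isBot_and_not_isTop_iff {G : FaceLattice P} :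
    (¬ IsBot G ∧ ¬ IsTop G) ↔ IsNontrivialFace P G.1 := by
  rw [isBot_faceLattice_iff, isTop_faceLattice_iff]
  exact ⟨fun h => ⟨G.2, h.1, h.2⟩, fun h => ⟨h.2.1, h.2.2⟩⟩

theorem isFlagPair_faceLattice_iff {p : FaceLattice P × (FaceLattice P)ᵒᵈ} :
    IsFlagPair p ↔ (p.1.1 = ∅ ∧ (OrderDual.ofDual p.2).1 = P) ∨
      (p.1.1 = P ∧ (OrderDual.ofDual p.2).1 = ∅) ∨
      (IsNontrivialFace P p.1.1 ∧ IsNontrivialFace P (OrderDual.ofDual p.2).1 ∧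
        p.1.1 ⊆ (OrderDual.ofDual p.2).1) := by
  rw [IsFlagPair, not_isBot_and_not_isTop_iff, not_isBot_and_not_isTop_iff]
  simp only [isBot_faceLattice_iff, isTop_faceLattice_iff]
  rfl

/-- The adjoined pairs give the trivial faces by the same formula: a sum with `∅` is `∅`, and the
dual face of `∅` is all of `P*`. -/
theorem PerfectlyCentered.isFace_add_dualFace [FiniteDimensional ℝ E]
    (hP : IsPolytope P) (hfull : (interior P).Nonempty)
    (hpc : PerfectlyCentered P) {p : FaceLattice P × (FaceLattice P)ᵒᵈ} (hp : IsFlagPair p) :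
    IsFace (nesterovRounding P) (p.1.1 + dualFace P (OrderDual.ofDual p.2).1) := by
  rcases isFlagPair_faceLattice_iff.1 hp with ⟨h1, -⟩ | ⟨h1, h2⟩ | ⟨h1, h2, h3⟩
  · rw [h1, Set.empty_add]
    exact isFace_empty _
  · rw [h1, h2, dualFace_empty]
    exact isFace_self _
  · exact ((hpc.isNontrivialFace_nesterovRounding_iff hP hfull _).2 ⟨_, _, h1, h2, h3, rfl⟩).1

theorem PerfectlyCentered.add_dualFace_le_iff [FiniteDimensional ℝ E]
    (hP : IsPolytope P) (hfull : (interior P).Nonempty)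
    (hpc : PerfectlyCentered P) {p q : FaceLattice P × (FaceLattice P)ᵒᵈ} (hp : IsFlagPair p)
    (hq : IsFlagPair q) :
    p.1.1 + dualFace P (OrderDual.ofDual p.2).1 ⊆ q.1.1 + dualFace P (OrderDual.ofDual q.2).1 ↔
      p ≤ q := by
  have hle : p ≤ q ↔ p.1.1 ⊆ q.1.1 ∧ (OrderDual.ofDual q.2).1 ⊆ (OrderDual.ofDual p.2).1 := Iff.rfl
  have hN : (P + dual P).Nonempty := nesterovRounding_nonempty hfull
  have hPne : P.Nonempty := hfull.mono interior_subset
  have hpN := IsExposed.subset (hpc.isFace_add_dualFace hP hfull hp)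
  have hpP : p.1.1 ⊆ P := IsExposed.subset p.1.2
  have hqP : (OrderDual.ofDual q.2).1 ⊆ P := IsExposed.subset (OrderDual.ofDual q.2).2
  rw [hle]
  rcases isFlagPair_faceLattice_iff.1 hp with ⟨p1, p2⟩ | ⟨p1, p2⟩ | ⟨p1, p2, p3⟩
  · simp [p1, p2, hqP]
  · rcases isFlagPair_faceLattice_iff.1 hq with ⟨q1, q2⟩ | ⟨q1, q2⟩ | ⟨q1, q2, q3⟩
    · simp only [p1, p2, q1, q2, dualFace_empty, Set.empty_add, Set.subset_empty_iff]
      simp [hN.ne_empty, hPne.ne_empty]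
    · simp [p1, p2, q1, q2]
    · have hn := (hpc.isNontrivialFace_nesterovRounding_iff hP hfull _).2
        ⟨_, _, q1, q2, q3, rfl⟩
      rw [p1, p2, dualFace_empty]
      constructor
      · exact fun h => absurd ((IsExposed.subset hn.1).antisymm h) hn.2.2
      · exact fun h => absurd ((IsExposed.subset q1.1).antisymm h.1) q1.2.2
  · rcases isFlagPair_faceLattice_iff.1 hq with ⟨q1, q2⟩ | ⟨q1, q2⟩ | ⟨q1, q2, q3⟩
    · have hn := (hpc.isNontrivialFace_nesterovRounding_iff hP hfull _).2
        ⟨_, _, p1, p2, p3, rfl⟩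
      rw [q1, Set.empty_add, Set.subset_empty_iff, Set.subset_empty_iff]
      exact ⟨fun h => absurd h hn.2.1, fun h => absurd h.1 p1.2.1⟩
    · rw [q1, q2, dualFace_empty]
      exact ⟨fun _ => ⟨hpP, Set.empty_subset _⟩, fun _ => hpN⟩
    · exact hpc.add_dualFace_subset_iff hP p1 p2 q1 q2 q3

/-- The face lattice of the Nesterov rounding in terms of the face lattice of `P`. -/
theorem PerfectlyCentered.nonempty_flagPair_orderIso [FiniteDimensional ℝ E]
    (hP : IsPolytope P)
    (hfull : (interior P).Nonempty) (hpc : PerfectlyCentered P) :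
    Nonempty (FlagPair (FaceLattice P) ≃o FaceLattice (nesterovRounding P)) := by
  refine ⟨OrderIso.ofSurjective (OrderEmbedding.ofMapLEIff
    (fun p => ⟨_, hpc.isFace_add_dualFace hP hfull p.2⟩)
    fun p q => hpc.add_dualFace_le_iff hP hfull p.2 q.2) ?_⟩
  rintro ⟨H, hH⟩
  suffices h : ∃ G F : FaceLattice P, IsFlagPair (G, OrderDual.toDual F) ∧
      H = G.1 + dualFace P F.1 by
    obtain ⟨G, F, hp, h⟩ := h
    exact ⟨⟨(G, OrderDual.toDual F), hp⟩, Subtype.ext h.symm⟩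
  rcases eq_or_ne H ∅ with rfl | hne
  · exact ⟨⟨∅, isFace_empty P⟩, ⟨P, isFace_self P⟩,
      isFlagPair_faceLattice_iff.2 (Or.inl ⟨rfl, rfl⟩), Set.empty_add.symm⟩
  rcases eq_or_ne H (nesterovRounding P) with rfl | hnt
  · exact ⟨⟨P, isFace_self P⟩, ⟨∅, isFace_empty P⟩,
      isFlagPair_faceLattice_iff.2 (Or.inr (Or.inl ⟨rfl, rfl⟩)), by
        rw [dualFace_empty, nesterovRounding]⟩
  obtain ⟨G, F, hG, hF, hGF, rfl⟩ :=
    (hpc.isNontrivialFace_nesterovRounding_iff hP hfull H).1 ⟨hH, hne, hnt⟩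
  exact ⟨⟨G, hG.1⟩, ⟨F, hF.1⟩, isFlagPair_faceLattice_iff.2 (Or.inr (Or.inr ⟨hG, hF, hGF⟩)), rfl⟩

end FaceLattice

end Polytope

theorem theorem1 {d : ℕ} (P : Set (EuclideanSpace ℝ (Fin d)))
    (hP : Polytope.IsPolytope P) (hPfull : (interior P).Nonempty)
    (hPpc : Polytope.PerfectlyCentered P) :
    (∀ H : Set (EuclideanSpace ℝ (Fin d)),
      Polytope.IsNontrivialFace (Polytope.nesterovRounding P) H ↔
        ∃ G F : Set (EuclideanSpace ℝ (Fin d)),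
          Polytope.IsNontrivialFace P G ∧ Polytope.IsNontrivialFace P F ∧ G ⊆ F ∧
            H = G + Polytope.dualFace P F) ∧
    (∀ (e : ℕ) (Q : Set (EuclideanSpace ℝ (Fin e))),
      Polytope.IsPolytope Q → (interior Q).Nonempty → Polytope.PerfectlyCentered Q →
        Nonempty (Polytope.FaceLattice P ≃o Polytope.FaceLattice Q) →
          Nonempty (Polytope.FaceLattice (Polytope.nesterovRounding P) ≃o
            Polytope.FaceLattice (Polytope.nesterovRounding Q))) := by
  refine ⟨hPpc.isNontrivialFace_nesterovRounding_iff hP hPfull, ?_⟩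
  rintro e Q hQ hQfull hQpc ⟨Φ⟩
  obtain ⟨eP⟩ := hPpc.nonempty_flagPair_orderIso hP hPfull
  obtain ⟨eQ⟩ := hQpc.nonempty_flagPair_orderIso hQ hQfull
  exact ⟨eP.symm.trans ((Polytope.flagPairCongr Φ).trans eQ)⟩
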